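/- Conventions. Maps and morphisms are composed from left to right, and all categories are small. A \emph{category with subobjects} is a category $\mathcal C$ with a subcategory on all its objects that is a partial order $\subseteq$, whose morphisms $j(c,d)\colon c\to d$ ($c\subseteq d$), called inclusions, are monomorphisms of $\mathcal C$, such that $h$ is an inclusion whenever $f=hg$ with $f,g$ inclusions. A normal factorization of $f\colon c\to d$ is $f=euj(d',d)$ with $c'\subseteq c$, $d'\subseteq d$, $e\colon c\to c'$ such that $j(c',c)e=1_{c'}$, and $u\colon c'\to d'$ an isomorphism; then $f^\circ=eu$. A cone with vertex $d$ is a family of morphisms $\gamma(c)\colon c\to d$ (for all objects $c$) with $j(c,c')\gamma(c')=\gamma(c)$ whenever $c\subseteq c'$; it is normal if its $M$-set $M\gamma=\{c:\gamma(c)\text{ is an isomorphism}\}$ is non-empty. $\mathcal C$ is a \emph{normal category} if every morphism has a normal factorization, for every inclusion $j(c,d)$ there is $e$ with $j(c,d)e=1_c$, and every object $c$ is the vertex of a normal cone $\gamma$ with $\gamma(c)=1_c$. Then $f^\circ$ is uniquely determined by $f$. For a normal cone $\gamma$ with vertex $c_\gamma$ and an epimorphism $f\colon c_\gamma\to d$,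 let $\gamma*f$ be the normal cone $a\mapsto\gamma(a)f$; put $\gamma\cdot\sigma=\gamma*(\sigma(c_\gamma))^\circ$. The functor $H(\gamma;-)\colon\mathcal C\to\mathbf{Set}$ is given by $H(\gamma;c)=\{\gamma*f^\circ : f\in\mathcal C(c_\gamma,c)\}$ and $H(\gamma;g)\colon\gamma*f^\circ\mapsto\gamma*(fg)^\circ$. The \emph{normal dual} $N^*\mathcal C$ has as objects the functors $H(\epsilon;-)$ with $\epsilon\cdot\epsilon=\epsilon$, as morphisms the natural transformations, and as subobjects the subfunctors; $MH(\epsilon;-)=M\epsilon$. A \emph{local isomorphism} is an inclusion preserving, fully faithful functor $F$ that for every object $c$ restricts to an isomorphism of categories from $\langle c\rangle$ onto $\langle F(c)\rangle$, where $\langle c\rangle$ is the full subcategory on the subobjects of $c$. For normal categories $\mathcal C,\mathcal D$, a \emph{cross-connection} from $\mathcal D$ to $\mathcal C$ is a local isomorphism $\Gamma\colon\mathcal D\to N^*\mathcal C$ such that for every object $c$ of $\mathcal C$ there is an object $d$ of $\mathcal D$ with $c\in M\Gamma(d)$. Let $X$ be a set. The powerset category $\mathscr P(X)$ has as objects the non-empty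 proper subsets of $X$, as morphisms all functions between them, and as subobjects the subsets with their inclusion maps. The category of partitions $\Pi(X)$ has an object $\bar\pi$ for each partition $\pi$ of $X$ with at least one block of more than one element, where $\bar\pi$ is the set of all functions $\pi\to X$; its morphisms $\bar\pi_1\to\bar\pi_2$ are the maps $\eta^*\colon\alpha\mapsto\eta\alpha$ for arbitrary functions $\eta\colon\pi_2\to\pi_1$. One has $\bar\pi_1\subseteq\bar\pi_2$ if $\pi_2$ refines $\pi_1$, with inclusion $\nu^*$, where $\nu$ maps each block of $\pi_2$ to the block of $\pi_1$ containing it. Both are normal categories. An idempotent map $e\colon X\to X$ with kernel partition $\pi$ defines the idempotent normal cone $A\mapsto e|_A\colon A\to\operatorname{Im}e$ in $\mathscr P(X)$, whose $H$-functor $H(e;-)$ depends only on $\pi$. Let $Q\colon\Pi(X)\to N^*\mathscr P(X)$ be the functor with $Q(\bar\pi)=H(e;-)$, for such an $e$, which sends $\eta^*\colon\bar\pi_1\to\bar\pi_2$ to the natural transformation $H(e_1;-)\to H(e_2;-)$ with components $e_1*h^\circ\mapsto e_2*(wh)^\circ$ (writing $e_i$ also for the cone of $e_i$), where $w\colon\operatorname{Im}e_2\to\operatorname{Im}e_1$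 is the map that corresponds to $\eta\colon\pi_2\to\pi_1$ (image points being identified with the blocks that contain them). For a permutation $\theta$ of $X$, let $\Gamma_\theta\colon\Pi(X)\to N^*\mathscr P(X)$ be the functor $$\Gamma_\theta(\bar\sigma)=Q\bigl(\overline{\theta^{-1}(\sigma)}\bigr),\qquad \Gamma_\theta(\eta^*)=Q\bigl((\theta\eta\theta^{-1})^*\bigr),$$ where $\theta^{-1}(\sigma)=\{\theta^{-1}(A):A\in\sigma\}$ and $\theta$ also denotes the induced bijections $\theta^{-1}(\sigma)\to\sigma$. \textbf{Theorem.} Let $X$ be a set, finite or infinite, with at least two elements and $|X|\neq 3$. Then every cross-connection $\Gamma$ from $\Pi(X)$ to $\mathscr P(X)$ is equal to $\Gamma_\theta$ for some permutation $\theta$ of $X$. -/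

import Mathlib

open CategoryTheory

universe u

namespace CrossConn

/-! ### Categories with subobjects and normal categories

Mathlib's composition `f ≫ g` is written from left to right, as in the theory of cross-connections.
All categories are small. -/

/-- A choice of subobjects in a small category `C`: a subcategory, on all objects, that is a strict
preorder (a partial order, regarded as a category), whose morphisms `incl h` (the inclusions) are
monomorphisms of `C`, and such that `h` is an inclusion whenever `h ≫ j` and `j` are inclusions. -/
class HasSubobjects (C : Type u) [SmallCategory C] extends HasSubset C where
  incl : ∀ {c d : C}, c ⊆ d → (c ⟶ d)
  sub_refl : ∀ c : C, c ⊆ c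
  sub_trans : ∀ {a b c : C}, a ⊆ b → b ⊆ c → a ⊆ c
  sub_antisymm : ∀ {a b : C}, a ⊆ b → b ⊆ a → a = b
  incl_refl : ∀ c : C, incl (sub_refl c) = 𝟙 c
  incl_trans : ∀ {a b c : C} (h : a ⊆ b) (k : b ⊆ c), incl h ≫ incl k = incl (sub_trans h k)
  incl_mono : ∀ {a b : C} (h : a ⊆ b), Mono (incl h)
  sub_of_factor : ∀ {a b c : C} (hac : a ⊆ c) (hbc : b ⊆ c) (h : a ⟶ b),
    h ≫ incl hbc = incl hac → ∃ hab : a ⊆ b, h = incl hab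

section General

variable {C : Type u} [SmallCategory C] [HasSubobjects C]

/-- A normal factorization `f = e u j`: a retraction, an isomorphism and an inclusion. -/
structure NormalFactorization {c d : C} (f : c ⟶ d) where
  dom : C
  cod : C
  dom_sub : dom ⊆ c
  cod_sub : cod ⊆ d
  e : c ⟶ dom
  retraction : HasSubobjects.incl dom_sub ≫ e = 𝟙 dom
  u : dom ≅ cod
  fac : e ≫ u.hom ≫ HasSubobjects.incl cod_sub = f

theorem NormalFactorization.epi {c d : C} {f : c ⟶ d} (F : NormalFactorization f) :
    Epi (F.e ≫ F.u.hom) := by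
  have : IsSplitEpi F.e := ⟨⟨⟨_, F.retraction⟩⟩⟩
  infer_instance

theorem NormalFactorization.cod_sub_cod {c d : C} {f : c ⟶ d} (F G : NormalFactorization f) :
    ∃ h : F.cod ⊆ G.cod, F.e ≫ F.u.hom ≫ HasSubobjects.incl h = G.e ≫ G.u.hom := by
  have key : (F.u.inv ≫ HasSubobjects.incl F.dom_sub ≫ G.e ≫ G.u.hom) ≫
      HasSubobjects.incl G.cod_sub = HasSubobjects.incl F.cod_sub := by
    have h1 : G.e ≫ G.u.hom ≫ HasSubobjects.incl G.cod_sub =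
        F.e ≫ F.u.hom ≫ HasSubobjects.incl F.cod_sub := G.fac.trans F.fac.symm
    simp only [Category.assoc, h1]
    rw [← Category.assoc (HasSubobjects.incl F.dom_sub), F.retraction]
    simp
  obtain ⟨h, -⟩ := HasSubobjects.sub_of_factor F.cod_sub G.cod_sub _ key
  refine ⟨h, ?_⟩
  have := HasSubobjects.incl_mono G.cod_sub
  rw [← cancel_mono (HasSubobjects.incl G.cod_sub)]
  simp only [Category.assoc, HasSubobjects.incl_trans]
  rw [F.fac, G.fac]

/-- A cone from the base of all objects to the vertex `d`. -/
structure VertexCone (d : C) where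
  app : ∀ c : C, c ⟶ d
  w : ∀ {c c' : C} (h : c ⊆ c'), HasSubobjects.incl h ≫ app c' = app c

/-- A cone is normal if one of its components is an isomorphism. -/
def VertexCone.IsNormal {d : C} (γ : VertexCone d) : Prop := ∃ c : C, IsIso (γ.app c)

end General

/-- Normal categories. -/
class NormalCategory (C : Type u) [SmallCategory C] [HasSubobjects C] : Prop where
  factorization : ∀ {c d : C} (f : c ⟶ d), Nonempty (NormalFactorization f)
  splits : ∀ {c d : C} (h : c ⊆ d), ∃ e : d ⟶ c, HasSubobjects.incl h ≫ e = 𝟙 c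
  cone : ∀ c : C, ∃ γ : VertexCone c, γ.IsNormal ∧ γ.app c = 𝟙 c

/-- Normal cones, with arbitrary vertex; these are the elements of `T C`. -/
structure NormalCone (C : Type u) [SmallCategory C] [HasSubobjects C] where
  vertex : C
  cone : VertexCone vertex
  normal : cone.IsNormal

/-- The `M`-set of a normal cone. -/
def NormalCone.MSet {C : Type u} [SmallCategory C] [HasSubobjects C] (γ : NormalCone C) : Set C :=
  {c | IsIso (γ.cone.app c)}

section Normal

variable {C : Type u} [SmallCategory C] [HasSubobjects C] [NormalCategory C]

/-- A normal factorization of `f`. -/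
noncomputable def factorization {c d : C} (f : c ⟶ d) : NormalFactorization f :=
  (NormalCategory.factorization f).some

/-- The codomain of the epimorphic component of `f`. -/
noncomputable def image {c d : C} (f : c ⟶ d) : C := (factorization f).cod

theorem image_sub {c d : C} (f : c ⟶ d) : image f ⊆ d := (factorization f).cod_sub

/-- The epimorphic component `f° = e u` of `f = e u j`. It does not depend on the chosen
factorization, see `epiPart_unique`. -/
noncomputable def epiPart {c d : C} (f : c ⟶ d) : c ⟶ image f :=
  (factorization f).e ≫ (factorization f).u.hom

instance {c d : C} (f : c ⟶ d) : Epi (epiPart f) := (factorization f).epi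

theorem epiPart_incl {c d : C} (f : c ⟶ d) :
    epiPart f ≫ HasSubobjects.incl (image_sub f) = f :=
  (Category.assoc _ _ _).trans (factorization f).fac

/-- The epimorphic component does not depend on the normal factorization. -/
theorem epiPart_unique {c d : C} {f : c ⟶ d} (F : NormalFactorization f) :
    ∃ h : F.cod = image f, (F.e ≫ F.u.hom) ≫ eqToHom h = epiPart f := by
  obtain ⟨h1, k1⟩ := F.cod_sub_cod (factorization f)
  obtain ⟨h2, -⟩ := (factorization f).cod_sub_cod F
  have h : F.cod = image f := HasSubobjects.sub_antisymm h1 h2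
  refine ⟨h, ?_⟩
  have aux : ∀ {a b : C} (hab : a = b) (h' : a ⊆ b), HasSubobjects.incl h' = eqToHom hab := by
    rintro a b rfl h'
    simpa using HasSubobjects.incl_refl a
  rw [← aux h h1, Category.assoc]
  exact k1

/-- If `γ` is a normal cone and `f` an epimorphism from its vertex, the components `γ(a) f` form
a normal cone. -/
theorem star_normal (γ : NormalCone C) {d : C} (f : γ.vertex ⟶ d) [Epi f] :
    ∃ c : C, IsIso (γ.cone.app c ≫ f) := by
  obtain ⟨c, hc⟩ := γ.normal
  obtain ⟨F⟩ := NormalCategory.factorization f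
  -- the inclusion in the factorization of the epimorphism `f` is an isomorphism
  have hj : IsIso (HasSubobjects.incl F.cod_sub) := by
    obtain ⟨r, hr⟩ := NormalCategory.splits F.cod_sub
    refine ⟨r, hr, ?_⟩
    have hepi : Epi (HasSubobjects.incl F.cod_sub) := by
      have : Epi ((F.e ≫ F.u.hom) ≫ HasSubobjects.incl F.cod_sub) := by
        rw [Category.assoc, F.fac]; infer_instance
      exact epi_of_epi (F.e ≫ F.u.hom) _
    rw [← cancel_epi (HasSubobjects.incl F.cod_sub), ← Category.assoc, hr]
    simp
  -- transport the subobject on which `f` is invertible along `γ(c)`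
  obtain ⟨G⟩ := NormalCategory.factorization
    (HasSubobjects.incl F.dom_sub ≫ inv (γ.cone.app c))
  have hGe : IsIso G.e := by
    have hsplit : IsSplitEpi G.e := ⟨⟨⟨_, G.retraction⟩⟩⟩
    have hmono : Mono G.e := by
      have := HasSubobjects.incl_mono F.dom_sub
      have h2 : Mono (G.e ≫ (G.u.hom ≫ HasSubobjects.incl G.cod_sub)) := by
        rw [G.fac]; infer_instance
      exact mono_of_mono _ (G.u.hom ≫ HasSubobjects.incl G.cod_sub)
    exact isIso_of_mono_of_isSplitEpi _
  have hk : (G.e ≫ G.u.hom) ≫ γ.cone.app G.cod = HasSubobjects.incl F.dom_sub := by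
    rw [← γ.cone.w G.cod_sub, Category.assoc, ← Category.assoc G.u.hom, ← Category.assoc G.e, G.fac]
    simp
  have hk' : γ.cone.app G.cod = inv (G.e ≫ G.u.hom) ≫ HasSubobjects.incl F.dom_sub := by
    rw [IsIso.eq_inv_comp]; exact hk
  refine ⟨G.cod, ?_⟩
  have h3 : γ.cone.app G.cod ≫ f =
      inv (G.e ≫ G.u.hom) ≫ F.u.hom ≫ HasSubobjects.incl F.cod_sub := by
    have h4 : HasSubobjects.incl F.dom_sub ≫ f =
        HasSubobjects.incl F.dom_sub ≫ F.e ≫ F.u.hom ≫ HasSubobjects.incl F.cod_sub :=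
      congrArg (HasSubobjects.incl F.dom_sub ≫ ·) F.fac.symm
    rw [hk', Category.assoc, h4, ← Category.assoc (HasSubobjects.incl F.dom_sub), F.retraction,
      Category.id_comp]
  rw [h3]
  infer_instance

/-- The normal cone `γ ∗ f`, for an epimorphism `f` from the vertex of `γ`. -/
def NormalCone.star (γ : NormalCone C) {d : C} (f : γ.vertex ⟶ d) [Epi f] : NormalCone C where
  vertex := d
  cone :=
    { app := fun a => γ.cone.app a ≫ f
      w := fun h => by rw [← Category.assoc, γ.cone.w h] }
  normal := star_normal γ f

/-- The product `γ · σ = γ ∗ (σ(c_γ))°` of normal cones. -/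
noncomputable instance : Mul (NormalCone C) where
  mul γ σ := γ.star (epiPart (σ.cone.app γ.vertex))

theorem NormalCone.mul_def (γ σ : NormalCone C) :
    γ * σ = γ.star (epiPart (σ.cone.app γ.vertex)) := rfl

theorem NormalCone.star_injective (γ : NormalCone C) (c : C) :
    Function.Injective (fun f : γ.vertex ⟶ c => γ.star (epiPart f)) := by
  have aux : ∀ (δ δ' : NormalCone C) (_ : δ = δ') (h : δ.vertex ⊆ c) (h' : δ'.vertex ⊆ c) (a : C),
      δ.cone.app a ≫ HasSubobjects.incl h = δ'.cone.app a ≫ HasSubobjects.incl h' := by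
    rintro δ _ rfl h h' a
    rfl
  intro f f' hff
  obtain ⟨a, ha⟩ := γ.normal
  have h := aux _ _ hff (image_sub f) (image_sub f') a
  simp only [NormalCone.star, Category.assoc, epiPart_incl] at h
  exact (cancel_epi _).1 h

end Normal

/-! ### Set-valued functors, `H`-functors and the normal dual -/

/-- A functor from `C` to sets whose values are subsets of a fixed set `U`. -/
@[ext]
structure SetFunctor (C : Type u) [SmallCategory C] (U : Type u) where
  obj : C → Set U
  map : ∀ {c d : C}, (c ⟶ d) → obj c → obj d
  map_id : ∀ (c : C) (x : obj c), map (𝟙 c) x = x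
  map_comp : ∀ {c d e : C} (f : c ⟶ d) (g : d ⟶ e) (x : obj c), map (f ≫ g) x = map g (map f x)

/-- Natural transformations between set-valued functors. -/
@[ext]
structure SetFunctor.Hom {C : Type u} [SmallCategory C] {U : Type u} (F G : SetFunctor C U) where
  app : ∀ c : C, F.obj c → G.obj c
  naturality : ∀ {c d : C} (g : c ⟶ d) (x : F.obj c), app d (F.map g x) = G.map g (app c x)

instance {C : Type u} [SmallCategory C] {U : Type u} : SmallCategory (SetFunctor C U) where
  Hom F G := SetFunctor.Hom F G
  id F := { app := fun _ x => x, naturality := fun _ _ => rfl }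
  comp σ τ :=
    { app := fun c x => τ.app c (σ.app c x)
      naturality := fun g x => by rw [σ.naturality, τ.naturality] }

theorem SetFunctor.hom_ext {C : Type u} [SmallCategory C] {U : Type u} {F G : SetFunctor C U}
    {σ τ : F ⟶ G} (h : ∀ c x, σ.app c x = τ.app c x) : σ = τ :=
  SetFunctor.Hom.ext (funext fun c => funext fun x => h c x)

/-- `F` is a subfunctor of `G`. -/
def SetFunctor.IsSubfunctor {C : Type u} [SmallCategory C] {U : Type u} (F G : SetFunctor C U) :
    Prop :=
  ∃ h : ∀ c, F.obj c ⊆ G.obj c, ∀ {c d : C} (g : c ⟶ d) (x : F.obj c),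
    G.map g (Set.inclusion (h c) x) = Set.inclusion (h d) (F.map g x)

theorem SetFunctor.eq_of_isSubfunctor {C : Type u} [SmallCategory C] {U : Type u}
    {F G : SetFunctor C U} (h : F.IsSubfunctor G) (k : G.IsSubfunctor F) : F = G := by
  obtain ⟨Fo, Fm, F1, F2⟩ := F
  obtain ⟨Go, Gm, G1, G2⟩ := G
  obtain ⟨h, hm⟩ := h
  obtain ⟨k, -⟩ := k
  obtain rfl : Fo = Go := funext fun c => Set.Subset.antisymm (h c) (k c)
  congr
  funext c d g x
  exact (hm g x).symm

/-- The inclusion of a subfunctor. -/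
def SetFunctor.inclusion {C : Type u} [SmallCategory C] {U : Type u} {F G : SetFunctor C U}
    (h : F.IsSubfunctor G) : F ⟶ G where
  app c := Set.inclusion (h.1 c)
  naturality g x := (h.2 g x).symm

section Dual

variable {C : Type u} [SmallCategory C] [HasSubobjects C] [NormalCategory C]

/-- The set `H(γ; c) = {γ ∗ f° : f ∈ C(c_γ, c)}`. -/
def HSet (γ : NormalCone C) (c : C) : Set (NormalCone C) :=
  Set.range fun f : γ.vertex ⟶ c => γ.star (epiPart f)

/-- The bijection `f ↦ γ ∗ f°` from `C(c_γ, c)` onto `H(γ; c)`. -/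
noncomputable def hEquiv (γ : NormalCone C) (c : C) : (γ.vertex ⟶ c) ≃ HSet γ c :=
  Equiv.ofInjective _ (γ.star_injective c)

/-- The `H`-functor `H(γ; -)`; the map `H(γ; g)` is `γ ∗ f° ↦ γ ∗ (f g)°`. -/
noncomputable def HFunctor (γ : NormalCone C) : SetFunctor C (NormalCone C) where
  obj c := HSet γ c
  map g x := hEquiv γ _ ((hEquiv γ _).symm x ≫ g)
  map_id c x := by simp
  map_comp f g x := by simp

/-- The natural transformation `H(ε; -) ⟶ H(ε'; -)` with components `ε ∗ f° ↦ ε' ∗ (s f)°`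
induced by a morphism `s` from the vertex of `ε'` to the vertex of `ε`. -/
noncomputable def HFunctor.transformation {ε ε' : NormalCone C} (s : ε'.vertex ⟶ ε.vertex) :
    HFunctor ε ⟶ HFunctor ε' where
  app c x := hEquiv ε' c (s ≫ (hEquiv ε c).symm x)
  naturality g x := by simp [HFunctor]

theorem HFunctor.transformation_id (ε : NormalCone C) :
    HFunctor.transformation (𝟙 ε.vertex) = 𝟙 (HFunctor ε) :=
  SetFunctor.hom_ext fun c x => by
    change hEquiv ε c (𝟙 _ ≫ (hEquiv ε c).symm x) = x
    rw [Category.id_comp]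
    exact (hEquiv ε c).apply_symm_apply x

theorem HFunctor.transformation_comp {ε₁ ε₂ ε₃ : NormalCone C} (s : ε₂.vertex ⟶ ε₁.vertex)
    (t : ε₃.vertex ⟶ ε₂.vertex) :
    HFunctor.transformation (t ≫ s) =
      HFunctor.transformation s ≫ HFunctor.transformation t :=
  SetFunctor.hom_ext fun c x => by
    change hEquiv ε₃ c ((t ≫ s) ≫ (hEquiv ε₁ c).symm x) = hEquiv ε₃ c
      (t ≫ (hEquiv ε₂ c).symm (hEquiv ε₂ c (s ≫ (hEquiv ε₁ c).symm x)))
    simp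

end Dual

/-- The objects of the normal dual `N^* C`: the functors `H(ε; -)` for idempotent normal cones
`ε`. -/
@[ext]
structure NormalDual (C : Type u) [SmallCategory C] [HasSubobjects C] [NormalCategory C] where
  functor : SetFunctor C (NormalCone C)
  exists_idem : ∃ ε : NormalCone C, IsIdempotentElem ε ∧ functor = HFunctor ε

section Dual

variable {C : Type u} [SmallCategory C] [HasSubobjects C] [NormalCategory C]

/-- Morphisms of the normal dual are natural transformations. -/
instance : SmallCategory (NormalDual C) where
  Hom F G := F.functor ⟶ G.functor
  id F := 𝟙 F.functor
  comp {F G K} (σ : F.functor ⟶ G.functor) (τ : G.functor ⟶ K.functor) := σ ≫ τ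

/-- The subobjects in the normal dual are the subfunctors. -/
instance : HasSubobjects (NormalDual C) where
  Subset F G := F.functor.IsSubfunctor G.functor
  incl h := SetFunctor.inclusion h
  sub_refl F := ⟨fun _ => subset_rfl, fun _ _ => rfl⟩
  sub_trans h k := ⟨fun c => (h.1 c).trans (k.1 c), fun {c d} g x => by
    rw [← Set.inclusion_inclusion (h.1 c) (k.1 c) x, k.2 g, h.2 g, Set.inclusion_inclusion]⟩
  sub_antisymm h k := NormalDual.ext (SetFunctor.eq_of_isSubfunctor h k)
  incl_refl F := rfl
  incl_trans h k := rfl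
  incl_mono {F G} h := ⟨fun {E} σ τ hst => SetFunctor.hom_ext fun c x => by
    have h1 := congrArg (fun ρ : E.functor ⟶ G.functor => (ρ.app c x : NormalCone C)) hst
    exact Subtype.ext h1⟩
  sub_of_factor {F G K} hac hbc σ hσ := by
    have h1 : ∀ (c : C) (x : F.functor.obj c),
        (SetFunctor.Hom.app (F := F.functor) (G := G.functor) σ c x : NormalCone C) = x := fun c x =>
      congrArg (fun ρ : F.functor ⟶ K.functor => (ρ.app c x : NormalCone C)) hσ
    have hsub : ∀ c, F.functor.obj c ⊆ G.functor.obj c := fun c x hx =>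
      Set.mem_of_eq_of_mem (h1 c ⟨x, hx⟩).symm (Subtype.property _)
    refine ⟨⟨hsub, fun {c d} g x => ?_⟩, SetFunctor.hom_ext fun c x => Subtype.ext (h1 c x)⟩
    apply Subtype.ext
    have h3 := congrArg Subtype.val (hbc.2 g (Set.inclusion (hsub c) x))
    have h4 := congrArg Subtype.val (hac.2 g x)
    rw [Set.inclusion_inclusion] at h3
    exact h3.symm.trans h4

/-- The `M`-set of an object of the normal dual: `M H(ε; -) = M ε`. -/
def NormalDual.MSet (F : NormalDual C) : Set C :=
  {c | ∃ ε : NormalCone C, IsIdempotentElem ε ∧ F.functor = HFunctor ε ∧ c ∈ ε.MSet}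

end Dual

/-! ### Local isomorphisms and cross-connections -/

section Local

variable {C D : Type u} [SmallCategory C] [HasSubobjects C] [SmallCategory D] [HasSubobjects D]

/-- The principal ideal `⟨c⟩`: the full subcategory on the subobjects of `c`. -/
abbrev PrincipalIdeal (c : C) : Type u := ObjectProperty.FullSubcategory fun a : C => a ⊆ c

/-- Inclusion preserving functors. -/
structure InclusionPreserving (F : C ⥤ D) : Prop where
  sub : ∀ {a b : C}, a ⊆ b → F.obj a ⊆ F.obj b
  map_incl : ∀ {a b : C} (h : a ⊆ b), F.map (HasSubobjects.incl h) = HasSubobjects.incl (sub h)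

/-- The restriction of an inclusion preserving functor to a principal ideal. -/
def restrictIdeal (F : C ⥤ D) (hF : InclusionPreserving F) (c : C) :
    PrincipalIdeal c ⥤ PrincipalIdeal (F.obj c) :=
  ObjectProperty.lift _ (ObjectProperty.ι _ ⋙ F) fun a => hF.sub a.property

/-- Local isomorphisms: inclusion preserving, fully faithful functors whose restriction to each
principal ideal `⟨c⟩` is an isomorphism of categories onto `⟨F c⟩`. -/
structure LocalIsomorphism (F : C ⥤ D) : Prop where
  inclusionPreserving : InclusionPreserving F
  full : F.Full
  faithful : F.Faithful
  ideal_iso : ∀ c : C, ∃ G : PrincipalIdeal (F.obj c) ⥤ PrincipalIdeal c,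
    restrictIdeal F inclusionPreserving c ⋙ G = 𝟭 _ ∧
      G ⋙ restrictIdeal F inclusionPreserving c = 𝟭 _

end Local

/-- A cross-connection from `D` to `C`. -/
structure CrossConnection (D C : Type u) [SmallCategory D] [HasSubobjects D] [NormalCategory D]
    [SmallCategory C] [HasSubobjects C] [NormalCategory C] where
  functor : D ⥤ NormalDual C
  localIso : LocalIsomorphism functor
  total : ∀ c : C, ∃ d : D, c ∈ (functor.obj d).MSet

/-! ### The powerset category -/

/-- The objects of the powerset category: the non-empty proper subsets of `X`. -/
@[ext]
structure PowersetCat (X : Type u) where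
  carrier : Set X
  nonempty : carrier.Nonempty
  ne_univ : carrier ≠ Set.univ

namespace PowersetCat

variable {X : Type u}

/-- Morphisms from `A` to `B` are all functions from `A` to `B`. -/
instance : SmallCategory (PowersetCat X) where
  Hom A B := A.carrier → B.carrier
  id _ := id
  comp f g := g ∘ f

/-- Subobjects are subsets, inclusions are inclusion maps. -/
instance : HasSubobjects (PowersetCat X) where
  Subset A B := A.carrier ⊆ B.carrier
  incl h := Set.inclusion h
  sub_refl _ := subset_rfl
  sub_trans h k := Set.Subset.trans h k
  sub_antisymm h k := PowersetCat.ext (Set.Subset.antisymm h k)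
  incl_refl _ := rfl
  incl_trans _ _ := rfl
  incl_mono h := ⟨fun f g hfg => funext fun x => Set.inclusion_injective h (congrFun hfg x)⟩
  sub_of_factor {A B _} hac hbc f hf := by
    have h1 : ∀ x, (f x : X) = x := fun x => congrArg Subtype.val (congrFun hf x)
    exact ⟨fun x hx => Set.mem_of_eq_of_mem (h1 ⟨x, hx⟩).symm (f ⟨x, hx⟩).2,
      funext fun x => Subtype.ext (h1 x)⟩

/-- A bijection is an isomorphism. -/
noncomputable def isoOfBijective {A B : PowersetCat X} (f : A.carrier → B.carrier)
    (hf : Function.Bijective f) : A ≅ B where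
  hom := f
  inv := (Equiv.ofBijective f hf).symm
  hom_inv_id := funext (Equiv.ofBijective f hf).symm_apply_apply
  inv_hom_id := funext (Equiv.ofBijective f hf).apply_symm_apply

theorem ne_univ_of_sub {A : PowersetCat X} {s : Set X} (h : s ⊆ A.carrier) : s ≠ Set.univ :=
  fun hs => A.ne_univ (Set.univ_subset_iff.1 (hs ▸ h))

/-- The normal factorization of a function through a cross-section and its image. -/
noncomputable def normalFactorization {A B : PowersetCat X} (f : A.carrier → B.carrier) :
    NormalFactorization (C := PowersetCat X) (c := A) (d := B) f :=
  let s : Set.range f → A.carrier := fun b => b.2.choose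
  have hs : ∀ b, f (s b) = b := fun b => b.2.choose_spec
  have hA : Nonempty A.carrier := A.nonempty.to_subtype
  have h1 : Set.range (fun b => (s b : X)) ⊆ A.carrier := by
    rintro _ ⟨b, rfl⟩
    exact (s b).2
  have h2 : Set.range (fun a => (f a : X)) ⊆ B.carrier := by
    rintro _ ⟨a, rfl⟩
    exact (f a).2
  { dom := ⟨Set.range fun b => (s b : X), Set.range_nonempty _, ne_univ_of_sub h1⟩
    cod := ⟨Set.range fun a => (f a : X), Set.range_nonempty _, ne_univ_of_sub h2⟩
    dom_sub := h1
    cod_sub := h2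
    e := fun a => ⟨s ⟨f a, a, rfl⟩, ⟨f a, a, rfl⟩, rfl⟩
    retraction := by
      funext x
      obtain ⟨_, b, rfl⟩ := x
      apply Subtype.ext
      change (s ⟨f (s b), _⟩ : X) = s b
      congr 2
      exact Subtype.ext (hs b)
    u := isoOfBijective (fun x => ⟨f ⟨x, h1 x.2⟩, ⟨x, h1 x.2⟩, rfl⟩) (by
      constructor
      · rintro ⟨_, b, rfl⟩ ⟨_, b', rfl⟩ h
        have h3 : f (s b) = f (s b') := Subtype.ext (congrArg (fun z => (z.1 : X)) h)
        rw [hs b, hs b'] at h3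
        exact Subtype.ext (by rw [Subtype.ext h3])
      · rintro ⟨_, a, rfl⟩
        refine ⟨⟨s ⟨f a, a, rfl⟩, ⟨f a, a, rfl⟩, rfl⟩, Subtype.ext ?_⟩
        change (f (s ⟨f a, a, rfl⟩) : X) = f a
        rw [hs])
    fac := by
      funext a
      apply Subtype.ext
      exact congrArg Subtype.val (hs ⟨f a, a, rfl⟩) }

/-- The cone with vertex `D` whose components are the restrictions of `a : X → D`. -/
def coneOf (D : PowersetCat X) (a : X → D.carrier) : VertexCone D where
  app _ := fun x => a x
  w _ := rfl

theorem coneOf_app_self (D : PowersetCat X) (a : X → D.carrier) (ha : ∀ x : D.carrier, a x = x) :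
    (coneOf D a).app D = 𝟙 D := funext ha

theorem coneOf_isNormal (D : PowersetCat X) (a : X → D.carrier) (ha : ∀ x : D.carrier, a x = x) :
    (coneOf D a).IsNormal :=
  ⟨D, by rw [coneOf_app_self D a ha]; infer_instance⟩

theorem exists_retraction (D : PowersetCat X) : ∃ a : X → D.carrier, ∀ x : D.carrier, a x = x := by
  classical
  obtain ⟨d, hd⟩ := D.nonempty
  exact ⟨fun x => if h : x ∈ D.carrier then ⟨x, h⟩ else ⟨d, hd⟩, fun x => by simp⟩

instance : NormalCategory (PowersetCat X) where
  factorization f := ⟨normalFactorization f⟩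
  splits {A B} h := by
    obtain ⟨a, ha⟩ := exists_retraction A
    exact ⟨fun x => a x, funext fun x => ha x⟩
  cone D := by
    obtain ⟨a, ha⟩ := exists_retraction D
    exact ⟨coneOf D a, coneOf_isNormal D a ha, coneOf_app_self D a ha⟩

end PowersetCat

/-! ### The category of partitions -/

/-- The objects of the category of partitions: the non-identity partitions of `X`, given by their
equivalence relations. The blocks are the elements of the quotient. -/
@[ext]
structure PartitionCat (X : Type u) where
  rel : Setoid X
  ne_bot : rel ≠ ⊥

namespace PartitionCat

variable {X : Type u}

/-- The set of blocks of a partition. -/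
abbrev Blocks (π : PartitionCat X) : Type u := Quotient π.rel

/-- The map `η^* : α ↦ η α` from functions on `π₁` to functions on `π₂` induced by a map
`η : π₂ → π₁`. -/
def precomp {π₁ π₂ : PartitionCat X} (η : π₂.Blocks → π₁.Blocks) :
    (π₁.Blocks → X) → (π₂.Blocks → X) := fun α => α ∘ η

/-- The map `η` is determined by `η^*`, so that morphisms `η^*` may be represented by the maps
`η`. -/
theorem precomp_injective {π₁ π₂ : PartitionCat X} :
    Function.Injective (precomp (π₁ := π₁) (π₂ := π₂)) := by
  classical
  intro η η' h
  funext b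
  by_contra hne
  obtain ⟨x, y, hxy⟩ : ∃ x y : X, x ≠ y := by
    by_contra! hX
    exact π₁.ne_bot (Setoid.ext fun x y => ⟨fun _ => hX x y, fun h => h ▸ π₁.rel.refl x⟩)
  have h1 := congrFun (congrFun h fun c => if c = η b then x else y) b
  simp [precomp, Ne.symm hne, hxy] at h1

/-- Morphisms from `π₁` to `π₂` are the `η^*` for arbitrary maps of blocks `η : π₂ → π₁`
(note the direction); such a morphism is represented by `η`. As `η^* μ^* = (μ η)^*` (maps
written from left to right), the composite of `η` and `μ` is represented by `η ∘ μ`. -/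
instance : SmallCategory (PartitionCat X) where
  Hom π₁ π₂ := π₂.Blocks → π₁.Blocks
  id _ := id
  comp η μ := η ∘ μ

/-- `π₁` is a subobject of `π₂` if `π₂` refines `π₁`; the inclusion is `ν^*`, where `ν` maps a
block of `π₂` to the block of `π₁` containing it. -/
instance : HasSubobjects (PartitionCat X) where
  Subset π₁ π₂ := π₂.rel ≤ π₁.rel
  incl {π₁ π₂} h := (Quotient.map id h : π₂.Blocks → π₁.Blocks)
  sub_refl _ := le_rfl
  sub_trans h k := le_trans k h
  sub_antisymm h k := PartitionCat.ext (le_antisymm k h)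
  incl_refl _ := funext (Quotient.ind fun _ => rfl)
  incl_trans _ _ := funext (Quotient.ind fun _ => rfl)
  incl_mono {π₁ π₂} h := ⟨fun f g hfg => funext (Quotient.ind fun x =>
    congrFun hfg (Quotient.mk π₂.rel x))⟩
  sub_of_factor {π₁ π₂ π₃} hac hbc f hf := by
    have h1 : ∀ x, f (Quotient.mk π₂.rel x) = Quotient.mk π₁.rel x := fun x =>
      congrFun hf (Quotient.mk π₃.rel x)
    have h2 : π₂.rel ≤ π₁.rel := fun x y hxy => by
      apply Quotient.exact
      rw [← h1, ← h1, Quotient.sound hxy]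
    exact ⟨h2, funext (Quotient.ind h1)⟩

/-- A bijection of blocks is an isomorphism. -/
noncomputable def isoOfBijective {π₁ π₂ : PartitionCat X} (η : π₂.Blocks → π₁.Blocks)
    (hη : Function.Bijective η) : π₁ ≅ π₂ where
  hom := η
  inv := (Equiv.ofBijective η hη).symm
  hom_inv_id := funext (Equiv.ofBijective η hη).apply_symm_apply
  inv_hom_id := funext (Equiv.ofBijective η hη).symm_apply_apply

theorem ne_bot_of_le {π : PartitionCat X} {s : Setoid X} (h : π.rel ≤ s) : s ≠ ⊥ :=
  fun hs => π.ne_bot (le_bot_iff.1 (hs ▸ h))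

/-- The coarsening of `π` that identifies blocks with the same value under `φ`. -/
def coarsen (π : PartitionCat X) {T : Type u} (φ : π.Blocks → T) : PartitionCat X where
  rel := Setoid.ker fun x => φ (Quotient.mk π.rel x)
  ne_bot := ne_bot_of_le (π := π) fun _ _ h => congrArg φ (Quotient.sound h)

theorem coarsen_sub (π : PartitionCat X) {T : Type u} (φ : π.Blocks → T) : π.coarsen φ ⊆ π :=
  fun _ _ h => congrArg φ (Quotient.sound h)

/-- The injective map on the blocks of the coarsening induced by `φ`. -/
def coarsenLift (π : PartitionCat X) {T : Type u} (φ : π.Blocks → T) : (π.coarsen φ).Blocks → T :=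
  Quotient.lift (fun x => φ (Quotient.mk π.rel x)) fun _ _ h => h

theorem coarsenLift_injective (π : PartitionCat X) {T : Type u} (φ : π.Blocks → T) :
    Function.Injective (π.coarsenLift φ) := by
  intro b b'
  induction b using Quotient.ind
  induction b' using Quotient.ind
  exact fun h => Quotient.sound h

theorem exists_normalFactorization {π₁ π₂ : PartitionCat X} (η : π₂.Blocks → π₁.Blocks) :
    Nonempty (NormalFactorization (C := PartitionCat X) (c := π₁) (d := π₂) η) := by
  classical
  have hX : Nonempty X := by
    by_contra hX
    rw [not_nonempty_iff] at hX
    exact π₁.ne_bot (Setoid.ext fun x => hX.elim x)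
  obtain ⟨x₀⟩ := hX
  -- a retraction of the blocks of `π₁` onto the image of `η`
  let r : π₁.Blocks → π₁.Blocks := fun b =>
    if b ∈ Set.range η then b else η (Quotient.mk π₂.rel x₀)
  have hr : ∀ b, r b ∈ Set.range η := fun b => by
    by_cases hb : b ∈ Set.range η
    · simp only [r, if_pos hb]; exact hb
    · simp only [r, if_neg hb]; exact ⟨_, rfl⟩
  have hr' : ∀ b ∈ Set.range η, r b = b := fun b hb => by simp only [r, if_pos hb]
  let v : π₁.Blocks → (π₁.coarsen r).Blocks := HasSubobjects.incl (π₁.coarsen_sub r)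
  have hv : ∀ b, π₁.coarsenLift r (v b) = r b := Quotient.ind fun _ => rfl
  refine ⟨{ dom := π₁.coarsen r
            cod := π₂.coarsen η
            dom_sub := π₁.coarsen_sub r
            cod_sub := π₂.coarsen_sub η
            e := π₁.coarsenLift r
            retraction := ?_
            u := isoOfBijective (fun b => v (π₂.coarsenLift η b)) ⟨?_, ?_⟩
            fac := ?_ }⟩
  · funext b
    apply π₁.coarsenLift_injective r
    induction b using Quotient.ind with
    | _ x => exact (hv _).trans (hr' _ (hr _))
  · intro b b' h
    have h1 := congrArg (π₁.coarsenLift r) h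
    simp only [hv] at h1
    induction b using Quotient.ind with
    | _ x =>
      induction b' using Quotient.ind with
      | _ y =>
        change r (η (Quotient.mk _ x)) = r (η (Quotient.mk _ y)) at h1
        rw [hr' _ ⟨_, rfl⟩, hr' _ ⟨_, rfl⟩] at h1
        exact Quotient.sound h1
  · intro b
    obtain ⟨c, hc⟩ : ∃ c, η c = π₁.coarsenLift r b := by
      induction b using Quotient.ind with
      | _ x => exact hr _
    induction c using Quotient.ind with
    | _ y =>
      refine ⟨Quotient.mk _ y, π₁.coarsenLift_injective r ?_⟩
      rw [hv, ← hc]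
      exact hr' _ ⟨_, rfl⟩
  · funext b
    induction b using Quotient.ind with
    | _ y => exact (hv _).trans (hr' _ ⟨_, rfl⟩)

instance : NormalCategory (PartitionCat X) where
  factorization η := exists_normalFactorization η
  splits {π₁ π₂} h := by
    refine ⟨fun b : π₁.Blocks => Quotient.mk π₂.rel b.out, funext fun b => ?_⟩
    exact Quotient.out_eq b
  cone π := by
    let γ : VertexCone π :=
      { app := fun α => fun b : π.Blocks => Quotient.mk α.rel b.out
        w := fun _ => rfl }
    have h : γ.app π = 𝟙 π := funext fun b => Quotient.out_eq b
    exact ⟨γ, ⟨π, by rw [h]; infer_instance⟩, h⟩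

end PartitionCat

/-! ### The cross-connection induced by a permutation -/

section Induced

variable {X : Type u}

theorem NormalCone.mul_self_of_app_vertex {C : Type u} [SmallCategory C] [HasSubobjects C]
    [NormalCategory C] (γ : NormalCone C) (h : γ.cone.app γ.vertex = 𝟙 γ.vertex) :
    IsIdempotentElem γ := by
  have key : ∀ {d : C} (f : γ.vertex ⟶ d) [Epi f] (hd : d ⊆ γ.vertex),
      f ≫ HasSubobjects.incl hd = 𝟙 γ.vertex → γ.star f = γ := by
    intro d f _ hd hf
    rw [← HasSubobjects.incl_refl] at hf
    obtain ⟨hd', rfl⟩ := HasSubobjects.sub_of_factor _ hd f hf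
    obtain rfl : γ.vertex = d := HasSubobjects.sub_antisymm hd' hd
    obtain ⟨v, ⟨app, w⟩, n⟩ := γ
    simp [NormalCone.star, HasSubobjects.incl_refl]
  change γ * γ = γ
  rw [NormalCone.mul_def]
  exact key _ (image_sub _) (by rw [epiPart_incl, h])

/-- An idempotent transformation of `X` whose partition is `π`: it maps every element of a block to
a chosen representative of the block. -/
noncomputable def representative (π : PartitionCat X) (x : X) : X := (Quotient.mk π.rel x).out

theorem representative_idem (π : PartitionCat X) (x : X) :
    representative π (representative π x) = representative π x := by
  simp [representative]

theorem ker_representative (π : PartitionCat X) : Setoid.ker (representative π) = π.rel :=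
  Setoid.ext fun x y => by
    rw [Setoid.ker_def]
    simp only [representative, Quotient.out_inj]
    exact Quotient.eq

/-- The image of the idempotent transformation `representative π`. -/
noncomputable def representatives (π : PartitionCat X) : PowersetCat X where
  carrier := Set.range (representative π)
  nonempty := by
    by_contra h
    rw [Set.not_nonempty_iff_eq_empty, Set.range_eq_empty_iff] at h
    exact π.ne_bot (Setoid.ext fun x => h.elim x)
  ne_univ h := π.ne_bot <| by
    have h1 : ∀ x, representative π x = x := fun x => by
      obtain ⟨y, rfl⟩ : x ∈ Set.range (representative π) := h ▸ Set.mem_univ x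
      exact representative_idem π y
    rw [← ker_representative π]
    exact Setoid.ext fun x y => by rw [Setoid.ker_def, h1, h1]; rfl

/-- The normal cone of the idempotent transformation `representative π`: its vertex is the
image, its components are the restrictions. -/
noncomputable def representativeCone (π : PartitionCat X) : NormalCone (PowersetCat X) where
  vertex := representatives π
  cone := PowersetCat.coneOf (representatives π) fun x => ⟨representative π x, x, rfl⟩
  normal := PowersetCat.coneOf_isNormal _ _ <| by
    rintro ⟨_, x, rfl⟩
    exact Subtype.ext (representative_idem π x)

theorem representativeCone_idem (π : PartitionCat X) : IsIdempotentElem (representativeCone π) :=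
  NormalCone.mul_self_of_app_vertex _ <|
    PowersetCat.coneOf_app_self (representatives π) (fun x => ⟨representative π x, x, rfl⟩) <| by
      rintro ⟨_, x, rfl⟩
      exact Subtype.ext (representative_idem π x)

/-- The map between images of idempotents determined by a map `η` of blocks: it sends the
representative of a block `b` to the representative of `η b`. -/
noncomputable def blockMap {π₁ π₂ : PartitionCat X} (η : π₂.Blocks → π₁.Blocks) :
    (representatives π₂).carrier → (representatives π₁).carrier := fun x =>
  ⟨(η (Quotient.mk π₂.rel x)).out, (η (Quotient.mk π₂.rel x)).out, by simp [representative]⟩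

/-- The functor `Q : Π(X) ⥤ N^* 𝒫(X)` identifying `Π(X)` with the normal dual of `𝒫(X)`:
`Q π = H(e; -)`, where `e` is an idempotent transformation with partition `π`, and
`Q (η^*) : H(e; -) ⟶ H(f; -)` is `e h ↦ f w h`, where `w : Im f → Im e` is determined by `η`. -/
noncomputable def partitionToDual (X : Type u) : PartitionCat X ⥤ NormalDual (PowersetCat X) where
  obj π := ⟨HFunctor (representativeCone π), _, representativeCone_idem π, rfl⟩
  map {π₁ π₂} η := HFunctor.transformation (ε := representativeCone π₁)
    (ε' := representativeCone π₂) (blockMap η)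
  map_id π := by
    have h : blockMap (𝟙 π : π ⟶ π) = 𝟙 (representatives π) := by
      funext ⟨_, x, rfl⟩
      exact Subtype.ext (representative_idem π x)
    rw [h]
    exact HFunctor.transformation_id _
  map_comp {π₁ π₂ π₃} η μ := by
    have h : blockMap (η ≫ μ : π₁ ⟶ π₃) = CategoryStruct.comp (obj := PowersetCat X)
        (X := representatives π₃) (Y := representatives π₂) (Z := representatives π₁)
        (blockMap μ) (blockMap η) := by
      funext x
      apply Subtype.ext
      change (η (μ _)).out = (η (Quotient.mk π₂.rel (μ _).out)).out
      rw [Quotient.out_eq]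
    rw [h]
    exact HFunctor.transformation_comp (ε₁ := representativeCone π₁) (ε₂ := representativeCone π₂)
      (ε₃ := representativeCone π₃) (blockMap η) (blockMap μ)

/-- The bijection, induced by `θ`, from the blocks of `θ⁻¹(σ) = {θ⁻¹(A) : A ∈ σ}` to the blocks
of `σ`. -/
def permBlocks (θ : Equiv.Perm X) (σ : Setoid X) : Quotient (σ.comap θ) ≃ Quotient σ where
  toFun := Quotient.map θ fun _ _ h => h
  invFun := Quotient.map θ.symm fun x y h => by
    change σ.r _ _
    simpa using h
  left_inv := Quotient.ind fun x => by simp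
  right_inv := Quotient.ind fun x => by simp

/-- The functor on `Π(X)` induced by a permutation `θ`: a partition `σ` goes to `θ⁻¹(σ)`, and
`η^*` goes to `(θ η θ⁻¹)^*`, maps being written from left to right. -/
def permFunctor (θ : Equiv.Perm X) : PartitionCat X ⥤ PartitionCat X where
  obj σ :=
    { rel := σ.rel.comap θ
      ne_bot := fun h => σ.ne_bot <| Setoid.ext fun x y => by
        have h1 := Setoid.ext_iff.1 h (θ.symm x) (θ.symm y)
        simpa [Setoid.comap_rel, Setoid.bot_def] using h1 }
  map {σ₁ σ₂} η := fun b => (permBlocks θ σ₁.rel).symm (η (permBlocks θ σ₂.rel b))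
  map_id σ := funext fun b => (permBlocks θ σ.rel).symm_apply_apply b
  map_comp {σ₁ σ₂ σ₃} η μ := funext fun b => by
    change (permBlocks θ σ₁.rel).symm (η (μ _)) = (permBlocks θ σ₁.rel).symm
      (η (permBlocks θ σ₂.rel ((permBlocks θ σ₂.rel).symm (μ _))))
    rw [Equiv.apply_symm_apply]

/-- The functor `Γ_θ` from `Π(X)` to the normal dual of `𝒫(X)`: the functor on `Π(X)` induced by
`θ`, followed by the identification of `Π(X)` with the normal dual of `𝒫(X)`. -/
noncomputable def permGamma (θ : Equiv.Perm X) : PartitionCat X ⥤ NormalDual (PowersetCat X) :=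
  permFunctor θ ⋙ partitionToDual X

end Induced

end CrossConn

namespace CrossConn

/-! ### Morphisms of the normal dual -/

section Dual

variable {C : Type u} [SmallCategory C]

/-! A normal cone in the powerset category consists of the restrictions of one transformation of
`X`, and its `H`-functor is determined by the kernel of that transformation, with subfunctors
corresponding to coarser kernels (`HFunctor.isSubfunctor_iff`). Hence `partitionToDual X` is fully
faithful, surjective on objects, and preserves and reflects inclusions, so a cross-connection
factors through it as a fully faithful inclusion preserving endofunctor `G` of `PartitionCat X`.

The blocks of `σ` are the morphisms from `σ` to the one-block partition, so `G` induces natural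
bijections from the blocks of `σ` to those of `G σ` (`exists_blocks_bijective`). Pulling back the
block of a point `x` along them selects a block of every `σ`, compatibly with coarsening. If `X` has
at least four points, such a coherent selection is given by a single point `θ x`
(`exists_point_of_coherent`); then `G σ` is the preimage of `σ` under `θ`. Surjectivity of `θ` comes
from the bijections on blocks, injectivity from totality of the cross-connection, applied to
complements of points. If `X` has two points, there is just one partition and the identity serves.
With three points coherence is too weak: the three two-block partitions have only the one-block
partition as a common coarsening, so their blocks can be selected independently. -/

theorem SetFunctor.exists_isSubfunctor_of_app_val {U : Type u} {F G : SetFunctor C U} (t : F ⟶ G)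
    (ht : ∀ c x, (t.app c x : U) = x) :
    ∃ h : F.IsSubfunctor G, t = SetFunctor.inclusion h := by
  have hsub : ∀ c, F.obj c ⊆ G.obj c := fun c x hx =>
    Set.mem_of_eq_of_mem (ht c ⟨x, hx⟩).symm (Subtype.property _)
  have happ : ∀ c x, t.app c x = Set.inclusion (hsub c) x := fun c x => Subtype.ext (ht c x)
  refine ⟨⟨hsub, fun g x => ?_⟩, SetFunctor.hom_ext happ⟩
  rw [← happ, ← happ, t.naturality]

variable [HasSubobjects C] [NormalCategory C]

/-- Yoneda: `hEquiv` represents `HFunctor ε` by the vertex of `ε`, so a natural transformation is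
determined by its value at the element that corresponds to the identity, and that value is
arbitrary. -/
theorem HFunctor.transformation_bijective (ε ε' : NormalCone C) :
    Function.Bijective (HFunctor.transformation (ε := ε) (ε' := ε')) := by
  constructor
  · intro s s' h
    have h1 := congrArg (fun t : HFunctor ε ⟶ HFunctor ε' =>
      t.app ε.vertex (hEquiv ε ε.vertex (𝟙 _))) h
    simp only [HFunctor.transformation, Equiv.symm_apply_apply, Category.comp_id] at h1
    exact (hEquiv ε' _).injective h1
  · intro t
    refine ⟨(hEquiv ε' _).symm (t.app ε.vertex (hEquiv ε ε.vertex (𝟙 _))),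
      SetFunctor.hom_ext fun c x => ?_⟩
    obtain ⟨f, rfl⟩ := (hEquiv ε c).surjective x
    have h1 := t.naturality f (hEquiv ε ε.vertex (𝟙 _))
    simp only [HFunctor, Equiv.symm_apply_apply, Category.id_comp] at h1
    simp only [HFunctor.transformation, Equiv.symm_apply_apply]
    exact h1.symm

end Dual

/-- A functor into the codomain of a fully faithful functor that is surjective on objects factors
through it strictly. -/
theorem exists_comp_eq_of_surjective_obj {A B D : Type u} [SmallCategory A] [SmallCategory B]
    [SmallCategory D] (Q : B ⥤ D) [Q.Full] [Q.Faithful] (hQ : Function.Surjective Q.obj)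
    (F : A ⥤ D) : ∃ G : A ⥤ B, G ⋙ Q = F := by
  choose o ho using fun a => hQ (F.obj a)
  refine ⟨{ obj := o
            map := fun f => Q.preimage (eqToHom (ho _) ≫ F.map f ≫ eqToHom (ho _).symm)
            map_id := fun a => Q.map_injective (by simp)
            map_comp := fun f g => Q.map_injective (by simp) }, ?_⟩
  exact CategoryTheory.Functor.ext ho fun a b f => by simp

/-! ### Normal cones in the powerset category -/

section Powerset

variable {X : Type u}

theorem PowersetCat.exists_notMem (A : PowersetCat X) : ∃ x, x ∉ A.carrier :=
  (Set.ne_univ_iff_exists_notMem _).1 A.ne_univ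

/-- The singleton of a point, in a set with a nonempty proper subset. -/
def PowersetCat.singleton (A : PowersetCat X) (x : X) : PowersetCat X where
  carrier := {x}
  nonempty := Set.singleton_nonempty x
  ne_univ h := by
    obtain ⟨y, hy⟩ := A.nonempty
    obtain ⟨z, hz⟩ := A.exists_notMem
    have hx : ∀ w, w = x := fun w => h.ge (Set.mem_univ w)
    exact hz (by rwa [hx z, ← hx y])

namespace NormalCone

/-- The transformation of `X` whose restrictions are the components of the cone. -/
def toFun (γ : NormalCone (PowersetCat X)) (x : X) : γ.vertex.carrier :=
  γ.cone.app (γ.vertex.singleton x) ⟨x, rfl⟩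

/-- The singleton of `x` is a subobject of `A`, and the cone condition for this inclusion fixes the
component of `A` at `x`. -/
theorem app_eq_toFun (γ : NormalCone (PowersetCat X)) (A : PowersetCat X) (x : A.carrier) :
    γ.cone.app A x = γ.toFun x :=
  congrFun (γ.cone.w (c := γ.vertex.singleton x) (c' := A) (by rintro _ rfl; exact x.2)) ⟨x, rfl⟩

theorem app_bijective {γ : NormalCone (PowersetCat X)} {A : PowersetCat X} (hA : A ∈ γ.MSet) :
    Function.Bijective fun x : A.carrier => γ.toFun x := by
  have : IsIso (γ.cone.app A) := hA
  have h : Function.Bijective (γ.cone.app A : A.carrier → γ.vertex.carrier) :=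
    Function.bijective_iff_has_inverse.2 ⟨inv (γ.cone.app A),
      congrFun (IsIso.hom_inv_id (γ.cone.app A)), congrFun (IsIso.inv_hom_id (γ.cone.app A))⟩
  have h1 : (γ.cone.app A : A.carrier → γ.vertex.carrier) = fun x : A.carrier => γ.toFun x :=
    funext (γ.app_eq_toFun A)
  exact h1 ▸ h

theorem toFun_surjective (γ : NormalCone (PowersetCat X)) : Function.Surjective γ.toFun := by
  obtain ⟨A, hA⟩ := γ.normal
  intro y
  obtain ⟨x, hx⟩ := (app_bijective hA).2 y
  exact ⟨x, hx⟩

/-- An object on which the cone is bijective is a proper subset, so a point outside it shares its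
value with a point inside. This makes the kernel an object of `PartitionCat X`. -/
theorem ker_toFun_ne_bot (γ : NormalCone (PowersetCat X)) : Setoid.ker γ.toFun ≠ ⊥ := by
  obtain ⟨A, hA⟩ := γ.normal
  obtain ⟨z, hz⟩ := A.exists_notMem
  obtain ⟨x, hx⟩ := (app_bijective hA).2 (γ.toFun z)
  intro h
  have h1 : (x : X) = z := (Setoid.ext_iff.1 h x z).1 hx
  exact hz (h1 ▸ x.2)

/-- The vertex need not be compared separately: it is the image of the transformation, since `toFun`
is surjective. -/
theorem ext_of_toFun {γ δ : NormalCone (PowersetCat X)}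
    (h : ∀ x, (γ.toFun x : X) = δ.toFun x) : γ = δ := by
  have hv : γ.vertex = δ.vertex := by
    apply PowersetCat.ext
    have hr : ∀ ε : NormalCone (PowersetCat X),
        ε.vertex.carrier = Set.range fun x => (ε.toFun x : X) := fun ε => by
      rw [← Function.comp_def Subtype.val, ε.toFun_surjective.range_comp, Subtype.range_val]
    rw [hr γ, hr δ]
    simp only [h]
  have happ : ∀ A x, (γ.cone.app A x : X) = (δ.cone.app A x : X) := fun A x => by
    rw [app_eq_toFun, app_eq_toFun, h]
  obtain ⟨v, ⟨app, w⟩, n⟩ := γ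
  obtain ⟨v', ⟨app', w'⟩, n'⟩ := δ
  obtain rfl : v = v' := hv
  obtain rfl : app = app' := funext fun A => funext fun x => Subtype.ext (happ A x)
  rfl

theorem toFun_hEquiv (γ : NormalCone (PowersetCat X)) {A : PowersetCat X} (f : γ.vertex ⟶ A)
    (x : X) : ((hEquiv γ A f : NormalCone (PowersetCat X)).toFun x : X) = f (γ.toFun x) :=
  congrArg Subtype.val (congrFun (epiPart_incl f) (γ.toFun x))

theorem ker_toFun_le {γ δ : NormalCone (PowersetCat X)} {A : PowersetCat X} (h : δ ∈ HSet γ A) :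
    Setoid.ker γ.toFun ≤ Setoid.ker δ.toFun := by
  obtain ⟨f, hf⟩ := (hEquiv γ A).surjective ⟨δ, h⟩
  obtain rfl : (hEquiv γ A f : NormalCone (PowersetCat X)) = δ := congrArg Subtype.val hf
  intro x y hxy
  refine Subtype.ext ?_
  rw [toFun_hEquiv, toFun_hEquiv, show γ.toFun x = γ.toFun y from hxy]

theorem mem_hSet_vertex (γ : NormalCone (PowersetCat X)) : γ ∈ HSet γ γ.vertex := by
  have h : (hEquiv γ γ.vertex (𝟙 _) : NormalCone (PowersetCat X)) = γ :=
    ext_of_toFun fun x => toFun_hEquiv γ (𝟙 _) x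
  exact Set.mem_of_eq_of_mem h.symm (Subtype.property _)

end NormalCone

/-- If the transformation of `γ` is that of `δ` followed by `w`, then `γ ∗ f°` and `δ ∗ (w f)°` are
the same cone. The natural transformations of this kind are the inclusions of subfunctors. -/
theorem HFunctor.transformation_app_val {γ δ : NormalCone (PowersetCat X)}
    (w : δ.vertex ⟶ γ.vertex) (hw : ∀ x, w (δ.toFun x) = γ.toFun x) (A : PowersetCat X)
    (y : (HFunctor γ).obj A) :
    ((HFunctor.transformation (ε := γ) (ε' := δ) w).app A y : NormalCone (PowersetCat X)) = y := by
  obtain ⟨f, rfl⟩ := (hEquiv γ A).surjective y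
  refine NormalCone.ext_of_toFun fun x => ?_
  change ((hEquiv δ A (w ≫ (hEquiv γ A).symm _) : NormalCone (PowersetCat X)).toFun x : X) = _
  rw [Equiv.symm_apply_apply]
  refine (δ.toFun_hEquiv (w ≫ f) x).trans ((congrArg (fun z => (f z : X)) (hw x)).trans ?_)
  exact (γ.toFun_hEquiv f x).symm

/-- Cones in `H(δ; -)` factor through `δ.toFun`, and `γ` itself lies in `H(γ; -)`. Conversely,
comparable kernels let `γ.toFun` factor through `δ.toFun`; the factor is obtained from a section of
`δ.toFun`. -/
theorem HFunctor.isSubfunctor_iff {γ δ : NormalCone (PowersetCat X)} :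
    (HFunctor γ).IsSubfunctor (HFunctor δ) ↔ Setoid.ker δ.toFun ≤ Setoid.ker γ.toFun := by
  constructor
  · rintro ⟨h, -⟩
    exact NormalCone.ker_toFun_le (h _ γ.mem_hSet_vertex)
  · intro h
    let s := Function.surjInv δ.toFun_surjective
    obtain ⟨h1, -⟩ := SetFunctor.exists_isSubfunctor_of_app_val _
      (HFunctor.transformation_app_val (γ := γ) (δ := δ) (fun y => γ.toFun (s y)) fun x =>
        h (Function.surjInv_eq δ.toFun_surjective (δ.toFun x)))
    exact h1

theorem HFunctor.eq_of_ker_toFun_eq {γ δ : NormalCone (PowersetCat X)}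
    (h : Setoid.ker γ.toFun = Setoid.ker δ.toFun) : HFunctor γ = HFunctor δ :=
  SetFunctor.eq_of_isSubfunctor (HFunctor.isSubfunctor_iff.2 h.ge)
    (HFunctor.isSubfunctor_iff.2 h.le)

/-! ### The functor `Q` -/

theorem ker_representativeCone_toFun (π : PartitionCat X) :
    Setoid.ker (representativeCone π).toFun = π.rel := by
  rw [← ker_representative π]
  exact Setoid.ext fun x y => Subtype.ext_iff

theorem partitionToDual_obj_surjective : Function.Surjective (partitionToDual X).obj := by
  intro F
  obtain ⟨ε, -, hε⟩ := F.exists_idem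
  refine ⟨⟨Setoid.ker ε.toFun, ε.ker_toFun_ne_bot⟩, NormalDual.ext ?_⟩
  rw [hε]
  exact HFunctor.eq_of_ker_toFun_eq (ker_representativeCone_toFun _)

theorem partitionToDual_obj_sub_iff {π₁ π₂ : PartitionCat X} :
    (partitionToDual X).obj π₁ ⊆ (partitionToDual X).obj π₂ ↔ π₁ ⊆ π₂ := by
  refine Iff.trans HFunctor.isSubfunctor_iff ?_
  rw [ker_representativeCone_toFun, ker_representativeCone_toFun]
  rfl

theorem partitionToDual_map_incl {π₁ π₂ : PartitionCat X} (h : π₁ ⊆ π₂)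
    (h' : (partitionToDual X).obj π₁ ⊆ (partitionToDual X).obj π₂) :
    (partitionToDual X).map (HasSubobjects.incl h) = HasSubobjects.incl h' := by
  obtain ⟨_, h1⟩ := SetFunctor.exists_isSubfunctor_of_app_val _
    (HFunctor.transformation_app_val (γ := representativeCone π₁) (δ := representativeCone π₂)
      (blockMap (HasSubobjects.incl h)) fun x => Subtype.ext <| by
        change (Quotient.map id _ (Quotient.mk π₂.rel (Quotient.mk π₂.rel x).out)).out = _
        rw [Quotient.out_eq]
        rfl)
  exact h1

/-- The representatives form a cross-section of the partition, so maps between blocks and maps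
between representatives are the same data. With `HFunctor.transformation_bijective` this makes
`partitionToDual` fully faithful. -/
theorem blockMap_bijective (π₁ π₂ : PartitionCat X) :
    Function.Bijective (blockMap (π₁ := π₁) (π₂ := π₂)) := by
  constructor
  · intro η μ h
    refine funext fun b => ?_
    have h1 := congrArg Subtype.val (congrFun h ⟨b.out, b.out, by simp [representative]⟩)
    simpa [blockMap] using h1
  · intro w
    refine ⟨fun b => Quotient.mk π₁.rel (w ⟨b.out, b.out, by simp [representative]⟩), ?_⟩
    funext ⟨_, x, rfl⟩
    apply Subtype.ext
    obtain ⟨y, hy⟩ : (w ⟨representative π₂ x, x, rfl⟩ : X) ∈ Set.range (representative π₁) :=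
      (w _).2
    have h1 : (Quotient.mk π₂.rel (representative π₂ x)).out = representative π₂ x :=
      representative_idem π₂ x
    simp only [blockMap, h1]
    rw [← hy]
    exact representative_idem π₁ y

instance : (partitionToDual X).Faithful where
  map_injective h :=
    (blockMap_bijective _ _).1 ((HFunctor.transformation_bijective _ _).1 h)

instance : (partitionToDual X).Full where
  map_surjective := (HFunctor.transformation_bijective (representativeCone _)
    (representativeCone _)).2.comp (blockMap_bijective _ _).2

/-- A cone `ε` witnessing membership has the same `H`-functor as the representative cone, so it is
constant on blocks of `π`, while it is injective on `A`. This is how totality enters the main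
argument. -/
theorem injOn_of_mem_mSet {π : PartitionCat X} {A : PowersetCat X}
    (hA : A ∈ ((partitionToDual X).obj π).MSet) {x y : X} (hx : x ∈ A.carrier)
    (hy : y ∈ A.carrier) (hxy : π.rel x y) : x = y := by
  obtain ⟨ε, -, hε, hA⟩ := hA
  have hle : Setoid.ker (representativeCone π).toFun ≤ Setoid.ker ε.toFun :=
    HFunctor.isSubfunctor_iff.1 (hε ▸ ⟨fun _ => subset_rfl, fun _ _ => rfl⟩)
  rw [ker_representativeCone_toFun] at hle
  exact congrArg Subtype.val ((NormalCone.app_bijective hA).1 (a₁ := ⟨x, hx⟩) (a₂ := ⟨y, hy⟩)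
    (hle hxy))

end Powerset

/-! ### Coherent families of blocks -/

section Limit

variable {X : Type u}

/-- The partition whose only block with more than one element is `{x, y}`. -/
def pairPartition {x y : X} (h : x ≠ y) : PartitionCat X where
  rel :=
    { r := fun a b => a = b ∨ (a = x ∨ a = y) ∧ (b = x ∨ b = y)
      iseqv := ⟨fun _ => Or.inl rfl, by grind, by grind⟩ }
  ne_bot h1 := h ((Setoid.ext_iff.1 h1 x y).1 (Or.inr ⟨Or.inl rfl, Or.inr rfl⟩))

theorem pairPartition_rel {x y : X} (h : x ≠ y) {a b : X} :
    (pairPartition h).rel a b ↔ a = b ∨ (a = x ∨ a = y) ∧ (b = x ∨ b = y) := Iff.rfl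

theorem pairPartition_rel_le {x y : X} (h : x ≠ y) {s : Setoid X} (hs : s x y) :
    (pairPartition h).rel ≤ s := by
  rintro a b (rfl | ⟨rfl | rfl, rfl | rfl⟩)
  exacts [s.refl _, s.refl _, hs, s.symm hs, s.refl _]

theorem PartitionCat.exists_rel (σ : PartitionCat X) : ∃ x y, x ≠ y ∧ σ.rel x y := by
  by_contra! h
  exact σ.ne_bot (Setoid.ext fun x y => ⟨fun hxy => by_contra fun hne => h x y hne hxy,
    fun hxy => hxy ▸ σ.rel.refl x⟩)

/-- If `X` has at least four elements, every coherent choice of blocks of the non-identity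
partitions is given by a point of `X`. -/
theorem exists_point_of_coherent [Nonempty X] (hw : ∀ x y z : X, ∃ w, w ≠ x ∧ w ≠ y ∧ w ≠ z)
    (r : PartitionCat X → X)
    (hr : ∀ σ τ : PartitionCat X, σ.rel ≤ τ.rel → τ.rel (r σ) (r τ)) :
    ∃ p, ∀ σ : PartitionCat X, σ.rel (r σ) p := by
  -- If `S` splits neither pair, the partition into `S` and its complement coarsens both pair
  -- partitions, so both selected blocks lie on the same side of `S`.
  have key : ∀ {x y u v : X} (hxy : x ≠ y) (huv : u ≠ v) (S : Set X), (x ∈ S ↔ y ∈ S) →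
      (u ∈ S ↔ v ∈ S) → r (pairPartition hxy) ∈ S → r (pairPartition huv) ∈ S := by
    intro x y u v hxy huv S h1 h2
    let τ : PartitionCat X := ⟨Setoid.ker (· ∈ S), fun h =>
      hxy ((Setoid.ext_iff.1 h x y).1 (propext h1))⟩
    have h3 : (r (pairPartition hxy) ∈ S) = (r τ ∈ S) :=
      hr _ τ (pairPartition_rel_le hxy (propext h1))
    have h4 : (r (pairPartition huv) ∈ S) = (r τ ∈ S) :=
      hr _ τ (pairPartition_rel_le huv (propext h2))
    rw [h3, h4]
    exact id
  -- Some pair partition selects a singleton block. Otherwise every pair selects itself, and for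
  -- disjoint pairs `{x, y}` and `{w, z}` the set `S = {x, y}` gives a contradiction; this takes
  -- four points.
  obtain ⟨x, y, hxy, hx, hy⟩ : ∃ (x y : X) (hxy : x ≠ y),
      r (pairPartition hxy) ≠ x ∧ r (pairPartition hxy) ≠ y := by
    by_contra! h
    obtain ⟨x⟩ := ‹Nonempty X›
    obtain ⟨y, hyx, -⟩ := hw x x x
    obtain ⟨z, hzx, hzy, -⟩ := hw x y y
    obtain ⟨w, hwx, hwy, hwz⟩ := hw x y z
    have h1 := key hyx hwz {x, y} (by simp) (by simp [*])
      (by have := h y x hyx; simp only [Set.mem_insert_iff, Set.mem_singleton_iff]; tauto)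
    have h2 := h w z hwz
    simp only [Set.mem_insert_iff, Set.mem_singleton_iff] at h1
    grind
  refine ⟨r (pairPartition hxy), fun σ => ?_⟩
  set p := r (pairPartition hxy)
  have avoid : ∀ {u v : X} (huv : u ≠ v), p ≠ u → p ≠ v → r (pairPartition huv) = p :=
    fun huv hu hv => key hxy huv {p} (by simp [hx.symm, hy.symm]) (by simp [hu.symm, hv.symm]) rfl
  obtain ⟨u, v, huv, hσ⟩ := σ.exists_rel
  refine σ.rel.trans (σ.rel.symm (hr _ σ (pairPartition_rel_le huv hσ)))
    (pairPartition_rel_le huv hσ ((pairPartition_rel huv).2 ?_))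
  by_cases hp : p = u ∨ p = v
  · refine Or.inr ⟨?_, hp⟩
    -- When `p` lies in `{u, v}`, a disjoint pair `{s, t}` avoids `p` and therefore selects `p`; the
    -- set `S = {u, v}` transfers this to the pair `{u, v}`.
    obtain ⟨s, hsu, hsv, -⟩ := hw u v v
    obtain ⟨t, htu, htv, hts⟩ := hw u v s
    have h1 := avoid hts (by grind) (by grind)
    exact key hts huv {u, v} (by simp [*]) (by simp) (by rw [h1]; exact hp)
  · exact Or.inl (avoid huv (by tauto) (by tauto))

end Limit

/-! ### Fully faithful inclusion preserving endofunctors of the category of partitions -/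

section Endofunctor

variable {X : Type u}

theorem PartitionCat.eqToHom_mk {π₁ π₂ : PartitionCat X} (h : π₁ = π₂) (x : X) :
    (eqToHom h : π₂.Blocks → π₁.Blocks) (Quotient.mk π₂.rel x) = Quotient.mk π₁.rel x := by
  subst h
  rfl

/-- The partition with a single block. -/
def PartitionCat.trivial (X : Type u) [Nontrivial X] : PartitionCat X where
  rel := ⊤
  ne_bot h := by
    obtain ⟨x, y, hxy⟩ := exists_pair_ne X
    exact hxy ((Setoid.ext_iff.1 h x y).1 _root_.trivial)

theorem PartitionCat.trivial_blocks_eq [Nontrivial X] (b c : (PartitionCat.trivial X).Blocks) :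
    b = c := by
  induction b using Quotient.ind
  induction c using Quotient.ind
  exact Quotient.sound _root_.trivial

/-- A fully faithful functor on partitions acts on morphisms through bijections of blocks. -/
theorem exists_blocks_bijective [Nontrivial X] (G : PartitionCat X ⥤ PartitionCat X) [G.Full]
    [G.Faithful] : ∃ g : ∀ σ : PartitionCat X, σ.Blocks → (G.obj σ).Blocks,
      (∀ σ, Function.Bijective (g σ)) ∧
      ∀ {σ₁ σ₂ : PartitionCat X} (η : σ₁ ⟶ σ₂) (b : σ₂.Blocks), G.map η (g σ₂ b) = g σ₁ (η b) := by
  let T := PartitionCat.trivial X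
  obtain ⟨x₀⟩ : Nonempty X := inferInstance
  let pt : (G.obj T).Blocks := Quotient.mk _ x₀
  -- `T` has only one endomorphism, so by fullness `G.obj T` has only one as well; its constant maps
  -- coincide and it has a single block.
  have hpt : ∀ b, b = pt := fun b => by
    obtain ⟨η, hη⟩ := G.map_surjective (X := T) (Y := T) (fun _ => b)
    obtain ⟨μ, hμ⟩ := G.map_surjective (X := T) (Y := T) (fun _ => pt)
    have h : η = μ := funext fun c => PartitionCat.trivial_blocks_eq _ _
    have h1 := hη.symm.trans ((congrArg G.map h).trans hμ)
    exact congrFun h1 pt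
  let point {σ : PartitionCat X} (b : σ.Blocks) : σ ⟶ T := fun _ => b
  refine ⟨fun σ b => G.map (point b) pt, fun σ => ⟨fun b c h => ?_, fun b => ?_⟩,
    fun {σ₁ σ₂} η b => ?_⟩
  · have h1 : G.map (point b) = G.map (point c) := funext fun a => by rw [hpt a]; exact h
    exact congrFun (G.map_injective h1) (Quotient.mk _ x₀)
  · obtain ⟨η, hη⟩ := G.map_surjective (X := σ) (Y := T) (fun _ => b)
    have h : point (η (Quotient.mk _ x₀)) = η :=
      funext fun c => congrArg η (PartitionCat.trivial_blocks_eq _ _)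
    exact ⟨η (Quotient.mk _ x₀), (congrArg (fun μ => G.map μ pt) h).trans (congrFun hη pt)⟩
  · exact (congrFun (G.map_comp η (point b)) pt).symm

/-- If `X` has three distinct points but not exactly three, no three points exhaust it. -/
theorem exists_ne_three (hX : Nat.card X ≠ 3) {a b c : X} (hab : a ≠ b) (hac : a ≠ c)
    (hbc : b ≠ c) (x y z : X) : ∃ w, w ≠ x ∧ w ≠ y ∧ w ≠ z := by
  classical
  by_contra! h
  have hmem : ∀ w : X, w ∈ ({x, y, z} : Finset X) := fun w => by
    simp only [Finset.mem_insert, Finset.mem_singleton]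
    by_contra! hw
    exact hw.2.2 (h w hw.1 hw.2.1)
  let _ : Fintype X := ⟨{x, y, z}, hmem⟩
  apply hX
  rw [Nat.card_eq_fintype_card]
  refine le_antisymm Finset.card_le_three ?_
  rw [← Finset.card_eq_three.2 ⟨a, b, c, hab, hac, hbc, rfl⟩]
  exact Finset.card_le_univ _

/-- A separating family of coherent choices of blocks comes from a surjection of `X`. -/
theorem exists_map_of_coherent [Nontrivial X] (hX : Nat.card X ≠ 3) (r : X → PartitionCat X → X)
    (hr : ∀ x, ∀ σ τ : PartitionCat X, σ.rel ≤ τ.rel → τ.rel (r x σ) (r x τ))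
    (hsep : ∀ y, ∀ σ : PartitionCat X, ∃ x, σ.rel (r x σ) y) :
    ∃ θ : X → X, Function.Surjective θ ∧ ∀ x, ∀ σ : PartitionCat X, σ.rel (r x σ) (θ x) := by
  by_cases h3 : ∃ a b c : X, a ≠ b ∧ a ≠ c ∧ b ≠ c
  · obtain ⟨a, b, c, hab, hac, hbc⟩ := h3
    have hw := exists_ne_three hX hab hac hbc
    choose θ hθ using fun x => exists_point_of_coherent hw (r x) (hr x)
    refine ⟨θ, fun y => ?_, hθ⟩
    -- For a pair that avoids `y`, the block of `y` is the singleton `{y}`; a selection that picks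
    -- this block must come from the point `y`.
    obtain ⟨u, huy, -⟩ := hw y y y
    obtain ⟨v, hvy, hvu, -⟩ := hw y u u
    obtain ⟨x, hx⟩ := hsep y (pairPartition hvu)
    refine ⟨x, ?_⟩
    have h := (pairPartition_rel hvu).1 ((pairPartition hvu).rel.trans
      ((pairPartition hvu).rel.symm (hθ x _)) hx)
    grind
  · push Not at h3
    -- With at most two points every non-identity partition has a single block, so any map satisfies
    -- the relation.
    refine ⟨id, Function.surjective_id, fun x σ => ?_⟩
    obtain ⟨a, b, hab, h⟩ := σ.exists_rel
    have hσ : ∀ y, σ.rel a y := fun y => by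
      by_cases hay : a = y
      · exact hay ▸ σ.rel.refl a
      · exact h3 a b y hab hay ▸ h
    exact σ.rel.trans (σ.rel.symm (hσ _)) (hσ _)

theorem eq_permFunctor [Nontrivial X] (hX : Nat.card X ≠ 3)
    (G : PartitionCat X ⥤ PartitionCat X) [G.Full] [G.Faithful] (hG : InclusionPreserving G)
    (htot : ∀ A : PowersetCat X, ∃ σ, ∀ x ∈ A.carrier, ∀ y ∈ A.carrier,
      (G.obj σ).rel x y → x = y) :
    ∃ θ : Equiv.Perm X, G = permFunctor θ := by
  obtain ⟨g, hg, hnat⟩ := exists_blocks_bijective G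
  -- `r x σ` represents the block of `σ` that `g σ` carries to the block of `x` in `G.obj σ`.
  -- Naturality of `g` at inclusions makes this selection coherent.
  choose r hr using fun (x : X) (σ : PartitionCat X) =>
    ((hg σ).2.comp Quotient.mk_surjective) (Quotient.mk (G.obj σ).rel x)
  have hr' : ∀ x σ y, σ.rel (r x σ) y ↔ g σ (Quotient.mk σ.rel y) = Quotient.mk _ x :=
    fun x σ y => by
      rw [← hr x σ, Function.comp_apply, (hg σ).1.eq_iff, eq_comm, Quotient.eq]
  obtain ⟨θ, hsurj, hθ⟩ := exists_map_of_coherent hX r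
    (fun x σ τ h => by
      refine τ.rel.symm ((hr' x τ _).2 ?_)
      have h1 := hnat (HasSubobjects.incl (c := τ) (d := σ) h) (Quotient.mk _ (r x σ))
      rw [hG.map_incl h, show g σ _ = _ from hr x σ] at h1
      exact h1.symm)
    (fun y σ => by
      obtain ⟨x, hx⟩ := Quotient.mk_surjective (g σ (Quotient.mk _ y))
      exact ⟨x, (hr' x σ y).2 hx.symm⟩)
  have hgθ : ∀ σ x, g σ (Quotient.mk _ (θ x)) = Quotient.mk _ x := fun σ x =>
    (hr' x σ _).1 (hθ x σ)
  have hrel : ∀ (σ : PartitionCat X) x y, (G.obj σ).rel x y ↔ σ.rel (θ x) (θ y) := fun σ x y => by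
    have h := (hg σ).1.eq_iff (a := Quotient.mk _ (θ x)) (b := Quotient.mk _ (θ y))
    rw [hgθ, hgθ] at h
    exact Quotient.eq.symm.trans (h.trans Quotient.eq)
  have hinj : Function.Injective θ := by
    intro x y hxy
    by_contra hne
    by_cases h3 : ∃ z, z ≠ x ∧ z ≠ y
    · obtain ⟨z, hzx, hzy⟩ := h3
      -- Points with equal images under `θ` are related in every `G.obj σ`, whereas totality
      -- provides a `σ` for which the complement of `z` meets each block at most once.
      obtain ⟨σ, hσ⟩ := htot ⟨{z}ᶜ, ⟨x, hzx.symm⟩, fun h => h.ge (Set.mem_univ z) rfl⟩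
      exact hne (hσ x hzx.symm y hzy.symm ((hrel σ x y).2 (hxy ▸ σ.rel.refl _)))
    · push Not at h3
      -- Here `x` and `y` exhaust `X`, so `θ` would be constant, against surjectivity onto two
      -- points.
      have hconst : ∀ z, θ z = θ x := fun z => by
        by_cases hz : z = x
        · rw [hz]
        · rw [h3 z hz, hxy]
      obtain ⟨x', rfl⟩ := hsurj x
      obtain ⟨y', rfl⟩ := hsurj y
      exact hne ((hconst x').trans (hconst y').symm)
  obtain ⟨θ, rfl⟩ : ∃ θ' : Equiv.Perm X, ⇑θ' = θ :=
    ⟨Equiv.ofBijective θ ⟨hinj, hsurj⟩, rfl⟩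
  have hobj : ∀ σ, G.obj σ = (permFunctor θ).obj σ := fun σ =>
    PartitionCat.ext (Setoid.ext (hrel σ))
  refine ⟨θ, CategoryTheory.Functor.ext hobj fun σ₁ σ₂ η => funext (Quotient.ind fun x => ?_)⟩
  obtain ⟨y, hy⟩ := Quotient.mk_surjective (η (Quotient.mk σ₂.rel (θ x)))
  have h1 : G.map η (Quotient.mk _ x) = Quotient.mk _ (θ.symm y) := by
    rw [← hgθ σ₂ x, hnat, ← hy, ← hgθ σ₁, Equiv.apply_symm_apply]
  have h2 : (permFunctor θ).map η (Quotient.mk _ x) = Quotient.mk _ (θ.symm y) := by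
    change (permBlocks θ σ₁.rel).symm (η (Quotient.mk σ₂.rel (θ x))) = _
    rw [← hy]
    rfl
  rw [h1]
  change _ = (eqToHom (hobj σ₁) : _ → (G.obj σ₁).Blocks) ((permFunctor θ).map η
    ((eqToHom (hobj σ₂).symm : (G.obj σ₂).Blocks → _) (Quotient.mk _ x)))
  rw [PartitionCat.eqToHom_mk, h2, PartitionCat.eqToHom_mk]

end Endofunctor

end CrossConn

theorem mainTheorem1 (X : Type*) [Nontrivial X] (hX : Nat.card X ≠ 3)
    (Γ : CrossConn.CrossConnection (CrossConn.PartitionCat X) (CrossConn.PowersetCat X)) :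
    ∃ θ : Equiv.Perm X, Γ.functor = CrossConn.permGamma θ := by
  open CrossConn in
  obtain ⟨F, hF, htot⟩ := Γ
  obtain ⟨G, rfl⟩ := exists_comp_eq_of_surjective_obj (partitionToDual X)
    partitionToDual_obj_surjective F
  have := hF.full
  have := hF.faithful
  have : G.Faithful := Functor.Faithful.of_comp G (partitionToDual X)
  have : G.Full := Functor.Full.of_comp_faithful G (partitionToDual X)
  -- Inclusions are pulled back along `partitionToDual X`, which reflects the subobject order and is
  -- faithful.
  have hG : InclusionPreserving G :=
    { sub := fun h => partitionToDual_obj_sub_iff.1 (hF.inclusionPreserving.sub h)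
      map_incl := fun h => (partitionToDual X).map_injective <|
        (hF.inclusionPreserving.map_incl h).trans (partitionToDual_map_incl _ _).symm }
  obtain ⟨θ, rfl⟩ := eq_permFunctor hX G hG fun A =>
    (htot A).imp fun σ hσ x hx y hy => injOn_of_mem_mSet hσ hx hy
  exact ⟨θ, rfl⟩
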